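/- **Setting.** Let $\Omega\subset\mathbb R^2$ be a bounded open set. For a colour $c=(r,g,b)\in\mathbb R^3$ put $$c_s=\Big(\tfrac{r-g}{\sqrt2},\ \tfrac{r+g-2b}{\sqrt6}\Big)\in\mathbb R^2,\qquad c_v=\tfrac{r+g+b}{\sqrt3}\in\mathbb R .$$ Fix $\alpha,h_0,\mu,\lambda>0$, a bounded measurable patch window $U\subset\mathbb R^2$, and a reference colour image $\mathbf g\in L^2_{\rm loc}(\mathbb R^2;\mathbb R^3)$ (for instance any bounded measurable image). With the Gaussian kernel $G_\alpha(t)=\frac1{2\pi\alpha^2}e^{-|t|^2/(2\alpha^2)}$ define the similarity weights $$\omega_s(x,y)=\exp\Big(-\frac{\int_U G_\alpha(t)\,|\mathbf g_s(x-t)-\mathbf g_s(y-t)|^2dt}{2h_0^2}\Big),\qquad \omega_v(x,y)=\exp\Big(-\frac{\int_U G_\alpha(t)\,|\mathbf g_v(x-t)-\mathbf g_v(y-t)|^2dt}{2h_0^2}\Big).$$ For a colour image $\mathbf u:\Omega\to\mathbb R^3$ let $$|\nabla^s_\omega\mathbf u|(x)=\Big(\int_\Omega|\mathbf u_s(y)-\mathbf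 u_s(x)|^2\omega_s(x,y)\,dy\Big)^{1/2},\qquad |\nabla^v_\omega\mathbf u|(x)=\Big(\int_\Omega|\mathbf u_v(y)-\mathbf u_v(x)|^2\omega_v(x,y)\,dy\Big)^{1/2},$$ $$\text{SVS-NLTV}(\mathbf u)=\int_\Omega|\nabla^s_\omega\mathbf u|\,dx+\mu\int_\Omega|\nabla^v_\omega\mathbf u|\,dx ,$$ and let $\text{SVS-NLBV}(\Omega)$ be the space of all $\mathbf u\in L^1(\Omega;\mathbb R^3)$ with $\int_\Omega|\nabla^s_\omega\mathbf u|\,dx+\int_\Omega|\nabla^v_\omega\mathbf u|\,dx<\infty$. Let the blurring kernel $K$ be a finite signed Borel measure on $\mathbb R^2$ (a kernel in $L^1(\mathbb R^2)$, or the Dirac mass at $0$ for pure denoising, are special cases), and let $(K*\mathbf u)(x)=\int\mathbf u(x-t)\,dK(t)$ for $x\in\Omega$, channel by channel, where $\mathbf u$ is extended by $0$ outside $\Omega$. Functions that agree a.e. on $\Omega$ are identified, and $|\cdot|$ is the Euclidean norm. **Theorem (existence and uniqueness).** 1. If $\mathbf f\in L^2(\Omega;\mathbb R^3)$, then the SVS-NLTV-L2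 model $$\min_{\mathbf u\in\text{SVS-NLBV}(\Omega)}\Big\{\text{SVS-NLTV}(\mathbf u)+\frac\lambda2\int_\Omega|(K*\mathbf u)(x)-\mathbf f(x)|^2dx\Big\}$$ has at least one minimizer. If moreover the map $\mathbf u\mapsto K*\mathbf u$ from $\text{SVS-NLBV}(\Omega)$ to functions on $\Omega$ is injective, then the minimizer is unique. 2. If $\mathbf f\in L^1(\Omega;\mathbb R^3)$, then the SVS-NLTV-L1 model $$\min_{\mathbf u\in\text{SVS-NLBV}(\Omega)}\Big\{\text{SVS-NLTV}(\mathbf u)+\frac\lambda2\int_\Omega|(K*\mathbf u)(x)-\mathbf f(x)|\,dx\Big\}$$ has at least one minimizer. -/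

import Mathlib

open MeasureTheory Filter
open scoped ENNReal NNReal

noncomputable section

namespace SVSNLTV

/-- The plane `ℝ²`, with its Euclidean norm and Lebesgue measure. -/
abbrev Plane : Type := EuclideanSpace ℝ (Fin 2)

/-- Colour values `(r, g, b) ∈ ℝ³`, with the Euclidean norm. -/
abbrev RGB : Type := EuclideanSpace ℝ (Fin 3)

/-- Saturation part of a colour:
`((r - g) / √2, (r + g - 2 b) / √6)`. -/
def sat (c : RGB) : EuclideanSpace ℝ (Fin 2) :=
  !₂[(c 0 - c 1) / √2, (c 0 + c 1 - 2 * c 2) / √6]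

/-- Value part of a colour: `(r + g + b) / √3`. -/
def val (c : RGB) : ℝ := (c 0 + c 1 + c 2) / √3

/-- The two-dimensional Gaussian kernel `G_α` with standard deviation `α`. -/
def gaussKernel (α : ℝ) (t : Plane) : ℝ :=
  (2 * Real.pi * α ^ 2)⁻¹ * Real.exp (-‖t‖ ^ 2 / (2 * α ^ 2))

/-- Saturation similarity of the patches of the image `g` at `x` and `y`:
`ω_s(x, y) = exp (- (∫_U G_α(t) ‖g_s(x - t) - g_s(y - t)‖² dt) / (2 h₀²))`. -/
def weightSat (U : Set Plane) (α h₀ : ℝ) (g : Plane → RGB) (x y : Plane) : ℝ :=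
  Real.exp (-(∫ t in U, gaussKernel α t * ‖sat (g (x - t)) - sat (g (y - t))‖ ^ 2)
    / (2 * h₀ ^ 2))

/-- Value similarity of the patches of the image `g` at `x` and `y`:
`ω_v(x, y) = exp (- (∫_U G_α(t) |g_v(x - t) - g_v(y - t)|² dt) / (2 h₀²))`. -/
def weightVal (U : Set Plane) (α h₀ : ℝ) (g : Plane → RGB) (x y : Plane) : ℝ :=
  Real.exp (-(∫ t in U, gaussKernel α t * |val (g (x - t)) - val (g (y - t))| ^ 2)
    / (2 * h₀ ^ 2))

/-- Nonlocal saturation gradient `∇_ω^s u (x, y) = (u_s(y) - u_s(x)) √ω_s(x, y)`. -/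
def gradSat (ωs : Plane → Plane → ℝ) (u : Plane → RGB) (x y : Plane) :
    EuclideanSpace ℝ (Fin 2) :=
  √(ωs x y) • (sat (u y) - sat (u x))

/-- Nonlocal value gradient `∇_ω^v u (x, y) = (u_v(y) - u_v(x)) √ω_v(x, y)`. -/
def gradVal (ωv : Plane → Plane → ℝ) (u : Plane → RGB) (x y : Plane) : ℝ :=
  √(ωv x y) * (val (u y) - val (u x))

/-- `|∇_ω^s u| (x) = (∫_Ω |∇_ω^s u (x, y)|² dy)^(1/2)`, possibly infinite. -/
def gradSatNorm (Ω : Set Plane) (ωs : Plane → Plane → ℝ) (u : Plane → RGB) (x : Plane) : ℝ≥0∞ :=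
  (∫⁻ y in Ω, ‖gradSat ωs u x y‖ₑ ^ 2) ^ (1 / 2 : ℝ)

/-- `|∇_ω^v u| (x) = (∫_Ω |∇_ω^v u (x, y)|² dy)^(1/2)`, possibly infinite. -/
def gradValNorm (Ω : Set Plane) (ωv : Plane → Plane → ℝ) (u : Plane → RGB) (x : Plane) : ℝ≥0∞ :=
  (∫⁻ y in Ω, ‖gradVal ωv u x y‖ₑ ^ 2) ^ (1 / 2 : ℝ)

/-- The space `SVS-NLBV(Ω)`: images `u ∈ L¹(Ω; ℝ³)` with
`∫_Ω |∇_ω^s u| dx + ∫_Ω |∇_ω^v u| dx < ∞`. Two functions that agree almost everywhere on `Ω`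
represent the same image. -/
def SVSNLBV (Ω : Set Plane) (ωs ωv : Plane → Plane → ℝ) : Set (Plane → RGB) :=
  {u | IntegrableOn u Ω ∧
    (∫⁻ x in Ω, gradSatNorm Ω ωs u x) + (∫⁻ x in Ω, gradValNorm Ω ωv u x) < ∞}

/-- `SVS-NLTV(u) = ∫_Ω |∇_ω^s u| dx + μ ∫_Ω |∇_ω^v u| dx`. -/
def svsnltv (Ω : Set Plane) (ωs ωv : Plane → Plane → ℝ) (μ : ℝ) (u : Plane → RGB) : ℝ≥0∞ :=
  (∫⁻ x in Ω, gradSatNorm Ω ωs u x) + ENNReal.ofReal μ * ∫⁻ x in Ω, gradValNorm Ω ωv u x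

/-- The blurred image `K * u`, `(K * u)(x) = ∫ u(x - t) dK(t)`, channel by channel, where `u` is
extended by zero outside `Ω`. The blurring kernel `K` is a finite signed Borel measure, integrated
through its Jordan decomposition: a kernel `k ∈ L¹(ℝ²)` is the measure `k(t) dt`, the
identity (pure denoising) is the Dirac mass at `0`, motion blur is a mass on a segment. -/
def blur (Ω : Set Plane) (K : SignedMeasure Plane) (u : Plane → RGB) (x : Plane) : RGB :=
  (∫ t, Ω.indicator u (x - t) ∂K.toJordanDecomposition.posPart)
    - ∫ t, Ω.indicator u (x - t) ∂K.toJordanDecomposition.negPart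

/-- Energy of the model with `L²` fidelity:
`SVS-NLTV(u) + (λ / 2) ∫_Ω |(K * u)(x) - f(x)|² dx`. -/
def energyL2 (Ω : Set Plane) (ωs ωv : Plane → Plane → ℝ) (μ lam : ℝ) (K : SignedMeasure Plane)
    (f u : Plane → RGB) : ℝ≥0∞ :=
  svsnltv Ω ωs ωv μ u + ENNReal.ofReal (lam / 2) * ∫⁻ x in Ω, ‖blur Ω K u x - f x‖ₑ ^ 2

/-- Energy of the model with `L¹` fidelity:
`SVS-NLTV(u) + (λ / 2) ∫_Ω |(K * u)(x) - f(x)| dx`. -/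
def energyL1 (Ω : Set Plane) (ωs ωv : Plane → Plane → ℝ) (μ lam : ℝ) (K : SignedMeasure Plane)
    (f u : Plane → RGB) : ℝ≥0∞ :=
  svsnltv Ω ωs ωv μ u + ENNReal.ofReal (lam / 2) * ∫⁻ x in Ω, ‖blur Ω K u x - f x‖ₑ

/-- `u` minimizes the energy `E` over the class `X` of admissible images. -/
def IsMinimizer (X : Set (Plane → RGB)) (E : (Plane → RGB) → ℝ≥0∞) (u : Plane → RGB) : Prop :=
  u ∈ X ∧ ∀ v ∈ X, E u ≤ E v

end SVSNLTV

end

/-! The similarity weights lie between a positive constant and 1 on `Ω × Ω`: a patch distance is at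
most a multiple of the integral of the squared norm of the reference over one large ball. Hence the
regularizer is comparable to a nonlocal energy with constant weight. The upper bound gives
SVS-NLTV(u) ≤ C‖u‖₂, and the lower bound gives a Poincaré inequality: u is within C · SVS-NLTV(u) of
a constant colour in L². So, when `Ω` is not null, SVS-NLBV(Ω) is exactly L²(Ω; ℝ³), and there
SVS-NLTV is a continuous seminorm `J` vanishing on constants (`mem_SVSNLBV_iff_memLp`,
`exists_seminorm_svsnltv`).

Blurring by a finite measure is bounded from L² to L² by Young's inequality, hence to L¹ as `Ω` has
finite measure. Both models thus become the minimization of J(u) + κ‖Tu - f‖^k over a Hilbert space,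
the residual being measured in L² or L¹ (`exists_energyLp_eq`).

This functional is continuous and convex, but coercive only up to the constants killed by `T`. These
form a finite-dimensional space along which it does not change, so it suffices to minimize on the
orthogonal complement (`exists_forall_seminorm_add_norm_pow_le`). For the squared fidelity, strict
convexity in Tu shows that all minimizers have the same blurred image; injectivity of the blur then
gives uniqueness. -/

namespace SVSNLTV

/-! ### Convex minimization in a Hilbert space -/

section Hilbert

variable {H : Type*} [NormedAddCommGroup H] [InnerProductSpace ℝ H]

/-- In a Hilbert space, a decreasing sequence of nonempty bounded closed convex sets has a common
point. -/
theorem nonempty_iInter_of_antitone_of_convex [CompleteSpace H] {C : ℕ → Set H}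
    (hanti : Antitone C) (hne : ∀ n, (C n).Nonempty) (hcl : ∀ n, IsClosed (C n))
    (hconv : ∀ n, Convex ℝ (C n)) (hb : Bornology.IsBounded (C 0)) : (⋂ n, C n).Nonempty := by
  -- The point of least norm of each set, with its variational inequality ⟨p, w - p⟩ ≥ 0.
  have hproj : ∀ n, ∃ p ∈ C n, ∀ w ∈ C n, ‖p‖ ^ 2 ≤ inner ℝ p w := by
    intro n
    obtain ⟨p, hp, hmin⟩ :=
      exists_norm_eq_iInf_of_complete_convex (hne n) (hcl n).isComplete (hconv n) 0
    refine ⟨p, hp, fun w hw => ?_⟩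
    have h := (norm_eq_iInf_iff_real_inner_le_zero (hconv n) hp).1 hmin w hw
    rw [zero_sub, inner_neg_left, inner_sub_right, real_inner_self_eq_norm_sq] at h
    linarith
  choose p hp hpw using hproj
  -- Since `p m` also lies in `C n`, the increments are controlled by those of the bounded
  -- increasing sequence ‖p n‖², so `p` is Cauchy. This replaces weak compactness.
  have hdist : ∀ {n m}, n ≤ m → ‖p m - p n‖ ^ 2 ≤ ‖p m‖ ^ 2 - ‖p n‖ ^ 2 := by
    intro n m hnm
    have h := hpw n (p m) (hanti hnm (hp m))
    rw [norm_sub_sq_real, real_inner_comm]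
    linarith
  have hmono : Monotone fun n => ‖p n‖ ^ 2 := fun n m hnm => by
    have := hdist hnm
    have := sq_nonneg ‖p m - p n‖
    dsimp only
    linarith
  obtain ⟨R, hR⟩ := hb.exists_norm_le
  have hbdd : BddAbove (Set.range fun n => ‖p n‖ ^ 2) := by
    refine ⟨R ^ 2, ?_⟩
    rintro _ ⟨n, rfl⟩
    have := hR _ (hanti (Nat.zero_le n) (hp n))
    dsimp only
    gcongr
  have hlim := tendsto_atTop_ciSup hmono hbdd
  set L := ⨆ n, ‖p n‖ ^ 2
  have hcauchy : CauchySeq p := by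
    refine cauchySeq_of_le_tendsto_0' (fun n => √(L - ‖p n‖ ^ 2)) (fun n m hnm => ?_) ?_
    · rw [dist_comm, dist_eq_norm]
      refine Real.le_sqrt_of_sq_le ((hdist hnm).trans ?_)
      have : ‖p m‖ ^ 2 ≤ L := le_ciSup hbdd m
      linarith
    · have h := (tendsto_const_nhds.sub hlim : Tendsto (fun n => L - ‖p n‖ ^ 2) atTop _)
      simpa using h.sqrt
  obtain ⟨x, hx⟩ := cauchySeq_tendsto_of_complete hcauchy
  refine ⟨x, Set.mem_iInter.2 fun n => (hcl n).mem_of_tendsto hx ?_⟩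
  filter_upwards [eventually_ge_atTop n] with m hm using hanti hm (hp m)

/-- The direct method: a continuous convex function which is bounded below and has bounded
sublevel sets in a closed convex subset of a Hilbert space attains its minimum there. -/
theorem exists_forall_le_of_convexOn [CompleteSpace H] {F : H → ℝ} (hF : Continuous F)
    (hconv : ConvexOn ℝ Set.univ F) (h0 : ∀ u, 0 ≤ F u) {V : Set H} (hV : V.Nonempty)
    (hVcl : IsClosed V) (hVc : Convex ℝ V)
    (hb : ∀ r, ∃ R, ∀ u ∈ V, F u ≤ r → ‖u‖ ≤ R) : ∃ u ∈ V, ∀ v ∈ V, F u ≤ F v := by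
  set m := sInf (F '' V)
  have hbelow : BddBelow (F '' V) := ⟨0, by rintro _ ⟨u, -, rfl⟩; exact h0 u⟩
  have hne : (⋂ n : ℕ, V ∩ {u | F u ≤ m + 1 / ((n : ℝ) + 1)}).Nonempty := by
    refine nonempty_iInter_of_antitone_of_convex
      (C := fun n : ℕ => V ∩ {u | F u ≤ m + 1 / ((n : ℝ) + 1)}) ?_ ?_ ?_ ?_ ?_
    · intro n k hnk u hu
      refine ⟨hu.1, (show F u ≤ _ from hu.2).trans ?_⟩
      have : (n : ℝ) ≤ k := by exact_mod_cast hnk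
      gcongr
    · intro n
      have hlt : m < m + 1 / ((n : ℝ) + 1) := lt_add_of_pos_right _ (by positivity)
      obtain ⟨_, ⟨u, hu, rfl⟩, h⟩ := exists_lt_of_csInf_lt (hV.image F) hlt
      exact ⟨u, hu, h.le⟩
    · exact fun n => hVcl.inter (isClosed_le hF continuous_const)
    · intro n
      refine hVc.inter ?_
      simpa using hconv.convex_le (m + 1 / ((n : ℝ) + 1))
    · obtain ⟨R, hR⟩ := hb (m + 1 / (((0 : ℕ) : ℝ) + 1))
      exact (Metric.isBounded_closedBall (x := (0 : H)) (r := R)).subset fun u hu => by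
        simpa using hR u hu.1 hu.2
  obtain ⟨u, hu⟩ := hne
  rw [Set.mem_iInter] at hu
  refine ⟨u, (hu 0).1, fun v hv => ?_⟩
  have hum : F u ≤ m := by
    have hlim := (tendsto_one_div_add_atTop_nhds_zero_nat (𝕜 := ℝ)).const_add m
    rw [add_zero] at hlim
    exact ge_of_tendsto' hlim fun n => (hu n).2
  exact hum.trans (csInf_le hbelow ⟨v, hv, rfl⟩)

/-- Minimizers of `J u + κ ‖T u - f‖ ^ k`, where the seminorm `J` controls the distance to a
finite-dimensional subspace on which it vanishes. -/
theorem exists_forall_seminorm_add_norm_pow_le [CompleteSpace H]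
    {G : Type*} [NormedAddCommGroup G] [NormedSpace ℝ G]
    (J : Seminorm ℝ H) (hJ : Continuous J) (S : Submodule ℝ H) [FiniteDimensional ℝ S]
    (hJS : ∀ a ∈ S, J a = 0) {C : ℝ} (hC : ∀ u, ∃ a ∈ S, ‖u - a‖ ≤ C * J u)
    (T : H →L[ℝ] G) (f : G) {κ : ℝ} (hκ : 0 < κ) {k : ℕ} (hk : k ≠ 0) :
    ∃ u, ∀ v, J u + κ * ‖T u - f‖ ^ k ≤ J v + κ * ‖T v - f‖ ^ k := by
  set F : H → ℝ := fun u => J u + κ * ‖T u - f‖ ^ k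
  -- The directions in `S` along which `F` is constant; coercivity can only hold transversally to
  -- them.
  set S₀ : Submodule ℝ H := S ⊓ LinearMap.ker (T : H →ₗ[ℝ] G)
  have : FiniteDimensional ℝ S₀ := Submodule.finiteDimensional_of_le inf_le_left
  have hFc : Continuous F := by fun_prop
  have hF0 : ∀ u, 0 ≤ F u := fun u => by
    have := apply_nonneg J u
    positivity
  have hnorm : ConvexOn ℝ Set.univ fun u => ‖T u - f‖ := by
    refine ⟨convex_univ, fun u _ v _ a b ha hb hab => ?_⟩
    have : T (a • u + b • v) - f = a • (T u - f) + b • (T v - f) := by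
      rw [map_add, map_smul, map_smul, smul_sub, smul_sub]
      nth_rewrite 1 [← one_smul ℝ f, ← hab, add_smul]
      abel
    beta_reduce
    rw [this]
    refine (norm_add_le _ _).trans_eq ?_
    rw [norm_smul, norm_smul, Real.norm_of_nonneg ha, Real.norm_of_nonneg hb]
    rfl
  have hFconv : ConvexOn ℝ Set.univ F :=
    J.convexOn.add ((hnorm.pow (fun _ _ => norm_nonneg _) k).smul hκ.le)
  -- `T` is injective on the finite-dimensional space `S ⊓ S₀ᗮ`, hence bounded below there.
  obtain ⟨c, -, hc⟩ := LinearMap.exists_antilipschitzWith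
    ((T : H →ₗ[ℝ] G).domRestrict (S ⊓ S₀ᗮ)) (by
      rw [LinearMap.ker_eq_bot']
      rintro ⟨x, hxS, hx⟩ hTx
      have hx0 : x ∈ S₀ := ⟨hxS, hTx⟩
      have := (Submodule.inf_orthogonal_eq_bot S₀).le ⟨hx0, hx⟩
      exact Subtype.ext this)
  have hinv : ∀ u, ∀ a ∈ S₀, F (u - a) = F u := by
    intro u a ha
    have hTa : T a = 0 := ha.2
    have hJa : J (u - a) = J u := by
      have h1 := map_sub_le_add J u a
      have h2 := map_add_le_add J (u - a) a
      rw [sub_add_cancel] at h2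
      have := hJS a ha.1
      linarith
    simp only [F, hJa, map_sub, hTa, sub_zero]
  have hbdd : ∀ r, ∃ R, ∀ u ∈ (S₀ᗮ : Set H), F u ≤ r → ‖u‖ ≤ R := by
    intro r
    refine ⟨|C| * r + c * (1 + r / κ + ‖f‖ + ‖T‖ * (|C| * r)), fun u hu hur => ?_⟩
    have hpow : 0 ≤ κ * ‖T u - f‖ ^ k := by positivity
    have hJu : J u ≤ r := by
      have : J u + κ * ‖T u - f‖ ^ k ≤ r := hur
      linarith
    have hTu : ‖T u - f‖ ≤ 1 + r / κ := by
      have h1 : κ * ‖T u - f‖ ^ k ≤ r := by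
        have : J u + κ * ‖T u - f‖ ^ k ≤ r := hur
        have := apply_nonneg J u
        linarith
      have h2 : ‖T u - f‖ ^ k ≤ r / κ := by
        rw [le_div_iff₀ hκ]; linarith
      -- The summand 1 covers residuals below 1, which their `k`-th power need not dominate.
      rcases le_total ‖T u - f‖ 1 with h | h
      · have : 0 ≤ ‖T u - f‖ ^ k := by positivity
        linarith
      · have := le_self_pow₀ h hk
        linarith
    obtain ⟨a, ha, hua⟩ := hC u
    -- Removing from `a` its `S₀` component keeps it in `S` and, by Pythagoras, brings it no farther
    -- from `u`, which is orthogonal to `S₀`.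
    set a₀ : H := S₀.starProjection a
    have ha₀ : a₀ ∈ S₀ := Submodule.starProjection_apply_mem _ _
    have ha₁ : a - a₀ ∈ S₀ᗮ := Submodule.sub_starProjection_mem_orthogonal a
    have hua₁ : ‖u - (a - a₀)‖ ≤ |C| * r := by
      have hle : ‖u - (a - a₀)‖ ≤ ‖u - a‖ := by
        have horth : inner ℝ (u - (a - a₀)) a₀ = 0 :=
          Submodule.inner_left_of_mem_orthogonal ha₀ (sub_mem hu ha₁)
        have hsq : ‖u - a‖ ^ 2 = ‖u - (a - a₀)‖ ^ 2 + ‖a₀‖ ^ 2 := by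
          rw [show u - a = u - (a - a₀) - a₀ by abel, norm_sub_sq_real, horth]
          ring
        have := sq_nonneg ‖a₀‖
        exact (sq_le_sq₀ (norm_nonneg _) (norm_nonneg _)).1 (by linarith)
      have hJ0 := apply_nonneg J u
      calc _ ≤ C * J u := hle.trans hua
        _ ≤ |C| * J u := by gcongr; exact le_abs_self C
        _ ≤ |C| * r := by gcongr
    have hTa : ‖T (a - a₀)‖ ≤ 1 + r / κ + ‖f‖ + ‖T‖ * (|C| * r) := by
      have heq : T (a - a₀) = (T u - f) + f - T (u - (a - a₀)) := by
        rw [map_sub T u]; abel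
      rw [heq]
      refine (norm_sub_le _ _).trans ?_
      have h1 := norm_add_le (T u - f) f
      have h2 := T.le_opNorm (u - (a - a₀))
      have h3 : ‖T‖ * ‖u - (a - a₀)‖ ≤ ‖T‖ * (|C| * r) := by gcongr
      linarith
    have hmem : a - a₀ ∈ S ⊓ S₀ᗮ := ⟨sub_mem ha ha₀.1, ha₁⟩
    have hna : ‖a - a₀‖ ≤ c * ‖T (a - a₀)‖ := by
      have h := hc.le_mul_dist ⟨a - a₀, hmem⟩ 0
      rw [map_zero, dist_zero_right, dist_zero_right] at h
      exact h
    calc ‖u‖ = ‖(u - (a - a₀)) + (a - a₀)‖ := by rw [sub_add_cancel]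
      _ ≤ ‖u - (a - a₀)‖ + ‖a - a₀‖ := norm_add_le _ _
      _ ≤ _ := by
        have := mul_le_mul_of_nonneg_left hTa c.2
        exact add_le_add hua₁ (hna.trans this)
  obtain ⟨u, -, hu⟩ := exists_forall_le_of_convexOn hFc hFconv hF0 ⟨0, S₀ᗮ.zero_mem⟩
    S₀.isClosed_orthogonal S₀ᗮ.convex hbdd
  -- Any competitor can be moved into `S₀ᗮ` without changing its energy.
  refine ⟨u, fun v => ?_⟩
  have h := hu (v - S₀.starProjection v) (Submodule.sub_starProjection_mem_orthogonal v)
  rw [hinv v _ (Submodule.starProjection_apply_mem _ _)] at h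
  exact h

/-- Two minimizers of `J u + κ ‖T u - f‖ ^ 2` have the same image under `T`. -/
theorem map_eq_of_forall_seminorm_add_norm_sq_le {E : Type*} [AddCommGroup E] [Module ℝ E]
    (J : Seminorm ℝ E) (T : E →ₗ[ℝ] H) (f : H) {κ : ℝ} (hκ : 0 < κ) {u v : E}
    (hu : ∀ w, J u + κ * ‖T u - f‖ ^ 2 ≤ J w + κ * ‖T w - f‖ ^ 2)
    (hv : ∀ w, J v + κ * ‖T v - f‖ ^ 2 ≤ J w + κ * ‖T w - f‖ ^ 2) : T u = T v := by
  -- By the parallelogram law, the midpoint has energy below the average by at least κ/4 ‖Tu - Tv‖².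
  set w : E := (1 / 2 : ℝ) • (u + v)
  have hJ : J w ≤ 1 / 2 * (J u + J v) := by
    rw [map_smul_eq_mul, Real.norm_of_nonneg (by norm_num)]
    gcongr
    exact map_add_le_add J u v
  have hT : T w - f = (1 / 2 : ℝ) • ((T u - f) + (T v - f)) := by
    simp only [w, map_smul, map_add]
    module
  have hTn : ‖T w - f‖ ^ 2 = 1 / 4 * ‖(T u - f) + (T v - f)‖ ^ 2 := by
    rw [hT, norm_smul, Real.norm_of_nonneg (by norm_num)]
    ring
  have hpar := parallelogram_law_with_norm ℝ (T u - f) (T v - f)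
  have h1 := hu w
  have h2 := hv w
  have h3 : κ * ‖T u - f - (T v - f)‖ ^ 2 ≤ 0 := by
    rw [hTn] at h1 h2
    have h4 : ‖(T u - f) + (T v - f)‖ ^ 2 = 2 * ‖T u - f‖ ^ 2 + 2 * ‖T v - f‖ ^ 2
        - ‖T u - f - (T v - f)‖ ^ 2 := by linarith
    rw [h4] at h1 h2
    nlinarith
  have h5 : ‖T u - f - (T v - f)‖ ^ 2 ≤ 0 := nonpos_of_mul_nonpos_right h3 hκ
  have h6 : ‖T u - f - (T v - f)‖ = 0 := by
    have := sq_nonneg ‖T u - f - (T v - f)‖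
    exact pow_eq_zero_iff two_ne_zero |>.1 (le_antisymm h5 this)
  rw [norm_eq_zero] at h6
  simpa [sub_eq_zero] using h6

end Hilbert

/-! ### Nonlocal total variation -/

theorem eLpNorm_two_eq_lintegral_rpow {α F : Type*} [MeasurableSpace α] [NormedAddCommGroup F]
    (ν : Measure α) (h : α → F) : eLpNorm h 2 ν = (∫⁻ x, ‖h x‖ₑ ^ 2 ∂ν) ^ (1 / 2 : ℝ) := by
  rw [eLpNorm_eq_lintegral_rpow_enorm_toReal two_ne_zero ENNReal.ofNat_ne_top]
  simp

theorem eLpNorm_two_sq_eq_lintegral {α F : Type*} [MeasurableSpace α] [NormedAddCommGroup F]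
    (ν : Measure α) (h : α → F) : eLpNorm h 2 ν ^ 2 = ∫⁻ x, ‖h x‖ₑ ^ 2 ∂ν := by
  rw [eLpNorm_two_eq_lintegral_rpow, ← ENNReal.rpow_natCast, ← ENNReal.rpow_mul]
  norm_num

section NonlocalTV

variable {α : Type*} [MeasurableSpace α] {F : Type*} [NormedAddCommGroup F] [NormedSpace ℝ F]

/-- The nonlocal total variation of `h` with weight `w`. -/
noncomputable def nonlocalTV (ν : Measure α) (w : α → α → ℝ) (h : α → F) : ℝ≥0∞ :=
  ∫⁻ x, eLpNorm (fun y => √(w x y) • (h y - h x)) 2 ν ∂ν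

variable {ν : Measure α} {w : α → α → ℝ} {h k : α → F}

theorem nonlocalTV_congr_ae (hk : h =ᵐ[ν] k) : nonlocalTV ν w h = nonlocalTV ν w k := by
  refine lintegral_congr_ae ?_
  filter_upwards [hk] with x hx
  refine eLpNorm_congr_ae ?_
  filter_upwards [hk] with y hy
  rw [hx, hy]

theorem nonlocalTV_const (a : F) : nonlocalTV ν w (fun _ => a) = 0 := by
  simp [nonlocalTV]

theorem nonlocalTV_smul (c : ℝ) : nonlocalTV ν w (c • h) = ‖c‖ₑ * nonlocalTV ν w h := by
  rw [nonlocalTV, nonlocalTV, ← lintegral_const_mul' _ _ enorm_ne_top]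
  refine lintegral_congr fun x => ?_
  rw [← eLpNorm_const_smul]
  congr 1
  ext y
  simp only [Pi.smul_apply, ← smul_sub]
  exact smul_comm _ _ _

theorem aestronglyMeasurable_weight_smul_sub (hw : Measurable (Function.uncurry w))
    (hh : AEStronglyMeasurable h ν) (x : α) :
    AEStronglyMeasurable (fun y => √(w x y) • (h y - h x)) ν :=
  (hw.of_uncurry_left (x := x)).sqrt.aestronglyMeasurable.smul
    (hh.sub aestronglyMeasurable_const)

theorem aemeasurable_eLpNorm_weight_smul_sub [SFinite ν] (hw : Measurable (Function.uncurry w))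
    (hh : AEStronglyMeasurable h ν) :
    AEMeasurable (fun x => eLpNorm (fun y => √(w x y) • (h y - h x)) 2 ν) ν := by
  simp_rw [eLpNorm_two_eq_lintegral_rpow]
  refine AEMeasurable.pow_const ?_ _
  refine AEMeasurable.lintegral_prod_right'
    (f := fun z : α × α => ‖√(w z.1 z.2) • (h z.2 - h z.1)‖ₑ ^ 2) ?_
  exact ((hw.sqrt.aestronglyMeasurable.smul (hh.comp_snd.sub hh.comp_fst)).enorm).pow_const 2

theorem nonlocalTV_add_le [SFinite ν] (hw : Measurable (Function.uncurry w))
    (hh : AEStronglyMeasurable h ν) (hk : AEStronglyMeasurable k ν) :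
    nonlocalTV ν w (h + k) ≤ nonlocalTV ν w h + nonlocalTV ν w k := by
  rw [nonlocalTV, nonlocalTV, nonlocalTV, ← lintegral_add_left'
    (aemeasurable_eLpNorm_weight_smul_sub hw hh)]
  refine lintegral_mono fun x => ?_
  refine le_trans (le_of_eq ?_) (eLpNorm_add_le (aestronglyMeasurable_weight_smul_sub hw hh x)
    (aestronglyMeasurable_weight_smul_sub hw hk x) one_le_two)
  congr 1
  ext y
  simp only [Pi.add_apply, ← smul_add]
  congr 1
  abel

/-- As √w ≤ 1, the triangle inequality bounds the gradient at `x` by ‖h‖₂ + |h(x)| ν(univ)^(1/2).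
After integration, Cauchy–Schwarz makes the second term as large as the first, whence the factor 2.
-/
theorem nonlocalTV_le [IsFiniteMeasure ν] (hw1 : ∀ x y, w x y ≤ 1)
    (hh : AEStronglyMeasurable h ν) :
    nonlocalTV ν w h ≤ 2 * ν Set.univ * eLpNorm h 2 ν := by
  have hle : ∀ x, eLpNorm (fun y => √(w x y) • (h y - h x)) 2 ν
      ≤ eLpNorm h 2 ν + ‖h x‖ₑ * ν Set.univ ^ (1 / 2 : ℝ) := by
    intro x
    have h1 : eLpNorm (fun y => √(w x y) • (h y - h x)) 2 ν
        ≤ eLpNorm (h - fun _ => h x) 2 ν := by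
      refine eLpNorm_mono fun y => ?_
      rw [norm_smul, Real.norm_of_nonneg (Real.sqrt_nonneg _)]
      exact mul_le_of_le_one_left (norm_nonneg _) (Real.sqrt_le_one.2 (hw1 x y))
    refine h1.trans ((eLpNorm_sub_le hh aestronglyMeasurable_const one_le_two).trans_eq ?_)
    congr 1
    rw [eLpNorm_const' _ two_ne_zero ENNReal.ofNat_ne_top]
    simp
  have h1 : ∫⁻ x, ‖h x‖ₑ ∂ν ≤ eLpNorm h 2 ν * ν Set.univ ^ (1 / 2 : ℝ) := by
    rw [← eLpNorm_one_eq_lintegral_enorm]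
    refine (eLpNorm_le_eLpNorm_mul_rpow_measure_univ one_le_two hh).trans_eq ?_
    norm_num
  calc nonlocalTV ν w h
      ≤ ∫⁻ x, (eLpNorm h 2 ν + ‖h x‖ₑ * ν Set.univ ^ (1 / 2 : ℝ)) ∂ν := lintegral_mono hle
    _ = eLpNorm h 2 ν * ν Set.univ + (∫⁻ x, ‖h x‖ₑ ∂ν) * ν Set.univ ^ (1 / 2 : ℝ) := by
        rw [lintegral_add_left measurable_const, lintegral_const,
          lintegral_mul_const' _ _ (by finiteness)]
    _ ≤ eLpNorm h 2 ν * ν Set.univ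
        + eLpNorm h 2 ν * ν Set.univ ^ (1 / 2 : ℝ) * ν Set.univ ^ (1 / 2 : ℝ) := by gcongr
    _ = 2 * ν Set.univ * eLpNorm h 2 ν := by
        rw [mul_assoc, ← ENNReal.rpow_add_of_nonneg _ _ (by norm_num) (by norm_num)]
        norm_num
        ring

/-- A nonlocal Poincaré inequality. -/
theorem exists_eLpNorm_sub_const_le_nonlocalTV [IsFiniteMeasure ν] (hν : ν ≠ 0) {c : ℝ}
    (hc : 0 < c) (hw : ∀ᵐ x ∂ν, ∀ᵐ y ∂ν, c ≤ w x y) (hh : AEStronglyMeasurable h ν) :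
    ∃ a : F, eLpNorm (fun y => h y - a) 2 ν
      ≤ ENNReal.ofReal (√c)⁻¹ * nonlocalTV ν w h / ν Set.univ := by
  have hsc : 0 < √c := Real.sqrt_pos.2 hc
  have hle : ENNReal.ofReal √c * ∫⁻ x, eLpNorm (fun y => h y - h x) 2 ν ∂ν
      ≤ nonlocalTV ν w h := by
    rw [← lintegral_const_mul' _ _ ENNReal.ofReal_ne_top]
    refine lintegral_mono_ae ?_
    filter_upwards [hw] with x hx
    rw [← Real.enorm_of_nonneg hsc.le, ← eLpNorm_const_smul]
    refine eLpNorm_mono_ae ?_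
    filter_upwards [hx] with y hy
    rw [Pi.smul_apply, norm_smul, norm_smul]
    gcongr
    rw [Real.norm_of_nonneg hsc.le, Real.norm_of_nonneg (Real.sqrt_nonneg _)]
    exact Real.sqrt_le_sqrt hy
  have hsc' : ENNReal.ofReal √c ≠ 0 := by simpa using hsc
  have hint : ∫⁻ x, eLpNorm (fun y => h y - h x) 2 ν ∂ν
      ≤ ENNReal.ofReal (√c)⁻¹ * nonlocalTV ν w h := by
    rw [ENNReal.ofReal_inv_of_pos hsc, ← ENNReal.div_eq_inv_mul,
      ENNReal.le_div_iff_mul_le (Or.inl hsc') (Or.inl ENNReal.ofReal_ne_top), mul_comm]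
    exact hle
  have hmeas : AEMeasurable (fun x => eLpNorm (fun y => h y - h x) 2 ν) ν := by
    simpa using aemeasurable_eLpNorm_weight_smul_sub (w := fun _ _ => 1) measurable_const hh
  -- The constant is a value `h x` at a point where ‖h - h x‖₂ does not exceed its average over `x`.
  obtain ⟨x, hx⟩ := exists_le_laverage hν hmeas
  refine ⟨h x, hx.trans ?_⟩
  rw [laverage_eq]
  gcongr

end NonlocalTV

/-! ### Convolution with a finite measure -/

section Translates

variable {G : Type*} [AddCommGroup G] [MeasurableSpace G] [MeasurableAdd₂ G] [MeasurableNeg G]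
  {ν : Measure G} [SFinite ν] [ν.IsAddRightInvariant] {m : Measure G} [IsFiniteMeasure m]

/-- Each translation preserves `ν`, so `m` may be singular, even a Dirac mass: changing a function
on a `ν`-null set affects its convolution only for `ν`-almost no `x`. -/
theorem quasiMeasurePreserving_sub_of_prod :
    Measure.QuasiMeasurePreserving (fun z : G × G => z.1 - z.2) (ν.prod m) ν :=
  QuasiMeasurePreserving.prod_of_left measurable_sub
    (Eventually.of_forall fun y => (measurePreserving_sub_right ν y).quasiMeasurePreserving)

theorem ae_ae_eq_comp_sub {β : Type*} {h k : G → β} (hhk : h =ᵐ[ν] k) :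
    ∀ᵐ x ∂ν, (fun t => h (x - t)) =ᵐ[m] fun t => k (x - t) :=
  Measure.ae_ae_of_ae_prod (quasiMeasurePreserving_sub_of_prod.ae_eq_comp hhk)

variable {E : Type*} [NormedAddCommGroup E] {h : G → E}

theorem aestronglyMeasurable_comp_sub (hh : AEStronglyMeasurable h ν) :
    AEStronglyMeasurable (fun z : G × G => h (z.1 - z.2)) (ν.prod m) :=
  hh.comp_quasiMeasurePreserving quasiMeasurePreserving_sub_of_prod

theorem aestronglyMeasurable_integral_comp_sub [NormedSpace ℝ E] (hh : AEStronglyMeasurable h ν) :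
    AEStronglyMeasurable (fun x => ∫ t, h (x - t) ∂m) ν :=
  (aestronglyMeasurable_comp_sub hh).integral_prod_right'

/-- Young's inequality for the exponent 2: Cauchy–Schwarz against `m`, then Tonelli and translation
invariance. -/
theorem lintegral_sq_lintegral_comp_sub_le (hh : AEStronglyMeasurable h ν) :
    ∫⁻ x, (∫⁻ t, ‖h (x - t)‖ₑ ∂m) ^ 2 ∂ν ≤ m Set.univ ^ 2 * ∫⁻ x, ‖h x‖ₑ ^ 2 ∂ν := by
  have hjoint := aestronglyMeasurable_comp_sub (m := m) hh
  calc ∫⁻ x, (∫⁻ t, ‖h (x - t)‖ₑ ∂m) ^ 2 ∂ν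
      ≤ ∫⁻ x, (∫⁻ t, ‖h (x - t)‖ₑ ^ 2 ∂m) * m Set.univ ∂ν := by
        refine lintegral_mono_ae ?_
        filter_upwards [hjoint.prodMk_left] with x hx
        have h1 := eLpNorm_le_eLpNorm_mul_rpow_measure_univ one_le_two hx
        rw [eLpNorm_one_eq_lintegral_enorm] at h1
        calc (∫⁻ t, ‖h (x - t)‖ₑ ∂m) ^ 2
            ≤ (eLpNorm (fun t => h (x - t)) 2 m *
                m Set.univ ^ (1 / (1 : ℝ≥0∞).toReal - 1 / (2 : ℝ≥0∞).toReal)) ^ 2 := by gcongr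
          _ = _ := by
            rw [mul_pow, eLpNorm_two_sq_eq_lintegral, ← ENNReal.rpow_natCast (_ ^ _),
              ← ENNReal.rpow_mul]
            norm_num
    _ = (∫⁻ t, ∫⁻ x, ‖h (x - t)‖ₑ ^ 2 ∂ν ∂m) * m Set.univ := by
        rw [lintegral_mul_const' _ _ (measure_ne_top _ _), lintegral_lintegral_swap]
        exact hjoint.enorm.pow_const 2
    _ = m Set.univ ^ 2 * ∫⁻ x, ‖h x‖ₑ ^ 2 ∂ν := by
        have : ∀ t, ∫⁻ x, ‖h (x - t)‖ₑ ^ 2 ∂ν = ∫⁻ x, ‖h x‖ₑ ^ 2 ∂ν := fun t =>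
          lintegral_sub_right_eq_self (fun x => ‖h x‖ₑ ^ 2) t
        simp_rw [this, lintegral_const]
        ring

theorem ae_integrable_comp_sub (hh : MemLp h 2 ν) :
    ∀ᵐ x ∂ν, Integrable (fun t => h (x - t)) m := by
  have hjoint := aestronglyMeasurable_comp_sub (m := m) hh.1
  have hfin : ∫⁻ x, (∫⁻ t, ‖h (x - t)‖ₑ ∂m) ^ 2 ∂ν ≠ ∞ := by
    refine ne_top_of_le_ne_top ?_ (lintegral_sq_lintegral_comp_sub_le hh.1)
    rw [← eLpNorm_two_sq_eq_lintegral]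
    have := hh.2
    finiteness
  have hmeas : AEMeasurable (fun x => (∫⁻ t, ‖h (x - t)‖ₑ ∂m) ^ 2) ν :=
    (hjoint.enorm.lintegral_prod_right').pow_const 2
  filter_upwards [ae_lt_top' hmeas hfin, hjoint.prodMk_left] with x hx hx'
  exact ⟨hx', by simpa [HasFiniteIntegral, ENNReal.pow_lt_top_iff] using hx⟩

theorem eLpNorm_integral_comp_sub_le [NormedSpace ℝ E] (hh : AEStronglyMeasurable h ν) :
    eLpNorm (fun x => ∫ t, h (x - t) ∂m) 2 ν ≤ m Set.univ * eLpNorm h 2 ν := by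
  have h1 : eLpNorm (fun x => ∫ t, h (x - t) ∂m) 2 ν ^ 2
      ≤ (m Set.univ * eLpNorm h 2 ν) ^ 2 := by
    rw [mul_pow, eLpNorm_two_sq_eq_lintegral, eLpNorm_two_sq_eq_lintegral]
    refine le_trans (lintegral_mono fun x => ?_) (lintegral_sq_lintegral_comp_sub_le hh)
    gcongr
    exact enorm_integral_le_lintegral_enorm _
  exact (ENNReal.pow_le_pow_left_iff two_ne_zero).1 h1

end Translates

/-! ### The blurring operator -/

section Blur

variable {Ω : Set Plane} {K : SignedMeasure Plane} {u v : Plane → RGB}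

theorem blur_congr_ae (hΩ : MeasurableSet Ω) (h : u =ᵐ[volume.restrict Ω] v) :
    blur Ω K u =ᵐ[volume] blur Ω K v := by
  have h' : Ω.indicator u =ᵐ[volume] Ω.indicator v := (ae_eq_restrict_iff_indicator_ae_eq hΩ).1 h
  filter_upwards [ae_ae_eq_comp_sub (m := K.toJordanDecomposition.posPart) h',
    ae_ae_eq_comp_sub (m := K.toJordanDecomposition.negPart) h'] with x hp hn
  rw [blur, blur, integral_congr_ae hp, integral_congr_ae hn]

theorem blur_add_ae (hΩ : MeasurableSet Ω) (hu : MemLp u 2 (volume.restrict Ω))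
    (hv : MemLp v 2 (volume.restrict Ω)) :
    blur Ω K (u + v) =ᵐ[volume] blur Ω K u + blur Ω K v := by
  have hu' := (memLp_indicator_iff_restrict hΩ).2 hu
  have hv' := (memLp_indicator_iff_restrict hΩ).2 hv
  filter_upwards [ae_integrable_comp_sub (m := K.toJordanDecomposition.posPart) hu',
    ae_integrable_comp_sub (m := K.toJordanDecomposition.negPart) hu',
    ae_integrable_comp_sub (m := K.toJordanDecomposition.posPart) hv',
    ae_integrable_comp_sub (m := K.toJordanDecomposition.negPart) hv'] with x hup hun hvp hvn
  simp only [blur, Set.indicator_add', Pi.add_apply]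
  rw [integral_add hup hvp, integral_add hun hvn]
  abel

theorem blur_smul (c : ℝ) : blur Ω K (c • u) = c • blur Ω K u := by
  ext1 x
  have h : ∀ z, Ω.indicator (c • u) z = c • Ω.indicator u z := fun z =>
    Set.indicator_const_smul_apply Ω c u z
  simp only [blur, h, integral_smul, Pi.smul_apply, smul_sub]

theorem aestronglyMeasurable_blur (hΩ : MeasurableSet Ω)
    (hu : AEStronglyMeasurable u (volume.restrict Ω)) :
    AEStronglyMeasurable (blur Ω K u) volume :=
  have hu' := (aestronglyMeasurable_indicator_iff hΩ).2 hu
  (aestronglyMeasurable_integral_comp_sub hu').sub (aestronglyMeasurable_integral_comp_sub hu')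

theorem eLpNorm_blur_le (hΩ : MeasurableSet Ω)
    (hu : AEStronglyMeasurable u (volume.restrict Ω)) :
    eLpNorm (blur Ω K u) 2 volume ≤ (K.toJordanDecomposition.posPart Set.univ
      + K.toJordanDecomposition.negPart Set.univ) * eLpNorm u 2 (volume.restrict Ω) := by
  have hu' := (aestronglyMeasurable_indicator_iff hΩ).2 hu
  refine (eLpNorm_sub_le (aestronglyMeasurable_integral_comp_sub hu')
    (aestronglyMeasurable_integral_comp_sub hu') one_le_two).trans ?_
  rw [add_mul, ← eLpNorm_indicator_eq_eLpNorm_restrict hΩ]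
  exact add_le_add (eLpNorm_integral_comp_sub_le hu') (eLpNorm_integral_comp_sub_le hu')

end Blur

/-! ### Saturation and value as orthonormal coordinates -/

section Colour

theorem norm_sat_sq_add_val_sq (c : RGB) : ‖sat c‖ ^ 2 + ‖val c‖ ^ 2 = ‖c‖ ^ 2 := by
  rw [EuclideanSpace.norm_sq_eq, EuclideanSpace.norm_sq_eq, Fin.sum_univ_two, Fin.sum_univ_three]
  simp only [sat, val, Real.norm_eq_abs, sq_abs, Matrix.cons_val_zero, Matrix.cons_val_one,
    div_pow]
  rw [Real.sq_sqrt (by norm_num), Real.sq_sqrt (by norm_num), Real.sq_sqrt (by norm_num)]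
  ring

theorem norm_sat_le (c : RGB) : ‖sat c‖ ≤ ‖c‖ := by
  have h := norm_sat_sq_add_val_sq c
  have := sq_nonneg ‖val c‖
  exact (sq_le_sq₀ (norm_nonneg _) (norm_nonneg _)).1 (by linarith)

theorem norm_val_le (c : RGB) : ‖val c‖ ≤ ‖c‖ := by
  have h := norm_sat_sq_add_val_sq c
  have := sq_nonneg ‖sat c‖
  exact (sq_le_sq₀ (norm_nonneg _) (norm_nonneg _)).1 (by linarith)

theorem norm_le_norm_sat_add_norm_val (c : RGB) : ‖c‖ ≤ ‖sat c‖ + ‖val c‖ := by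
  have h := norm_sat_sq_add_val_sq c
  have h1 := norm_nonneg (sat c)
  have h2 := norm_nonneg (val c)
  exact (sq_le_sq₀ (norm_nonneg _) (by positivity)).1 (by nlinarith)

/-- The saturation part as a linear map. -/
noncomputable def satLM : RGB →ₗ[ℝ] EuclideanSpace ℝ (Fin 2) where
  toFun := sat
  map_add' a b := by
    ext i
    fin_cases i <;> simp [sat] <;> ring
  map_smul' r a := by
    ext i
    fin_cases i <;> simp [sat] <;> ring

/-- The value part as a linear map. -/
noncomputable def valLM : RGB →ₗ[ℝ] ℝ where
  toFun := val
  map_add' a b := by simp [val]; ring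
  map_smul' r a := by simp [val]; ring

theorem sat_add (a b : RGB) : sat (a + b) = sat a + sat b := satLM.map_add a b

theorem sat_sub (a b : RGB) : sat (a - b) = sat a - sat b := satLM.map_sub a b

theorem sat_smul (r : ℝ) (a : RGB) : sat (r • a) = r • sat a := satLM.map_smul r a

theorem val_add (a b : RGB) : val (a + b) = val a + val b := valLM.map_add a b

theorem val_sub (a b : RGB) : val (a - b) = val a - val b := valLM.map_sub a b

theorem val_smul (r : ℝ) (a : RGB) : val (r • a) = r • val a := valLM.map_smul r a

theorem continuous_sat : Continuous sat := satLM.continuous_of_finiteDimensional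

theorem continuous_val : Continuous val := valLM.continuous_of_finiteDimensional

/-- The witness applies the transpose of the orthogonal matrix of the coordinate change. It merges
the separate Poincaré constants for saturation and value into one colour. -/
theorem exists_sat_eq_val_eq (s : EuclideanSpace ℝ (Fin 2)) (v : ℝ) :
    ∃ c : RGB, sat c = s ∧ val c = v := by
  refine ⟨!₂[s 0 / √2 + s 1 / √6 + v / √3, -(s 0 / √2) + s 1 / √6 + v / √3,
    -(2 * s 1 / √6) + v / √3], ?_, ?_⟩
  · have h2 : √2 * √2 = (2 : ℝ) := Real.mul_self_sqrt (by norm_num)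
    have h6 : √6 * √6 = (6 : ℝ) := Real.mul_self_sqrt (by norm_num)
    have h2' : √2 ≠ (0 : ℝ) := by positivity
    have h6' : √6 ≠ (0 : ℝ) := by positivity
    ext i
    fin_cases i
    · simp only [sat, Fin.zero_eta, Matrix.cons_val_zero, Matrix.cons_val_one]
      rw [div_eq_iff h2']
      calc _ = 2 * (s 0 / √2) := by ring
        _ = (√2 * √2) * (s 0 / √2) := by rw [h2]
        _ = _ := by field_simp
    · simp only [sat, Fin.mk_one, Matrix.cons_val_zero, Matrix.cons_val_one, Matrix.cons_val]
      rw [div_eq_iff h6']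
      calc _ = 6 * (s 1 / √6) := by ring
        _ = (√6 * √6) * (s 1 / √6) := by rw [h6]
        _ = _ := by field_simp
  · have h3 : √3 * √3 = (3 : ℝ) := Real.mul_self_sqrt (by norm_num)
    have h3' : √3 ≠ (0 : ℝ) := by positivity
    simp only [val, Matrix.cons_val_zero, Matrix.cons_val_one, Matrix.cons_val]
    rw [div_eq_iff h3']
    calc _ = 3 * (v / √3) := by ring
      _ = (√3 * √3) * (v / √3) := by rw [h3]
      _ = _ := by field_simp

end Colour

/-! ### Bounds and measurability of the similarity weights -/

section Weights

variable {F : Type*} [NormedAddCommGroup F] {U : Set Plane} {α h₀ : ℝ} {φ ψ : Plane → F}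

/-- The similarity of the patches of `φ` at `x` and `y`. -/
noncomputable def patchWeight (U : Set Plane) (α h₀ : ℝ) (φ : Plane → F) (x y : Plane) : ℝ :=
  Real.exp (-(∫ t in U, gaussKernel α t * ‖φ (x - t) - φ (y - t)‖ ^ 2) / (2 * h₀ ^ 2))

theorem gaussKernel_nonneg (t : Plane) : 0 ≤ gaussKernel α t := by
  unfold gaussKernel; positivity

theorem gaussKernel_le (t : Plane) : gaussKernel α t ≤ (2 * Real.pi * α ^ 2)⁻¹ := by
  refine mul_le_of_le_one_right (by positivity) (Real.exp_le_one_iff.2 ?_)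
  exact div_nonpos_of_nonpos_of_nonneg (by simp) (by positivity)

theorem continuous_gaussKernel : Continuous (gaussKernel α) := by
  unfold gaussKernel; fun_prop

/-- Equality holds at every pair, since each patch integral ignores null sets. A measurable
representative of the image therefore yields genuine joint measurability of the weight. -/
theorem patchWeight_congr_ae (h : φ =ᵐ[volume] ψ) :
    patchWeight U α h₀ φ = patchWeight U α h₀ ψ := by
  ext x y
  have hx : ∀ x : Plane, ∀ᵐ t ∂(volume : Measure Plane), φ (x - t) = ψ (x - t) := fun x =>
    (quasiMeasurePreserving_sub_left volume x).ae h
  simp only [patchWeight]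
  congr 3
  refine integral_congr_ae (ae_restrict_of_ae ?_)
  filter_upwards [hx x, hx y] with t h1 h2
  rw [h1, h2]

theorem measurable_patchWeight (hφ : AEStronglyMeasurable φ volume) :
    Measurable (Function.uncurry (patchWeight U α h₀ φ)) := by
  rw [patchWeight_congr_ae hφ.ae_eq_mk]
  have hm := hφ.stronglyMeasurable_mk
  have h1 : StronglyMeasurable fun z : (Plane × Plane) × Plane =>
      gaussKernel α z.2 * ‖hφ.mk φ (z.1.1 - z.2) - hφ.mk φ (z.1.2 - z.2)‖ ^ 2 :=
    (continuous_gaussKernel.measurable.comp measurable_snd).stronglyMeasurable.mul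
      (((hm.comp_measurable (by fun_prop)).sub (hm.comp_measurable (by fun_prop))).norm.pow 2)
  have h2 : StronglyMeasurable fun z : Plane × Plane => ∫ t in U,
      gaussKernel α t * ‖hφ.mk φ (z.1 - t) - hφ.mk φ (z.2 - t)‖ ^ 2 := h1.integral_prod_right'
  exact Real.measurable_exp.comp (h2.measurable.neg.div_const _)

theorem patchWeight_le_one (x y : Plane) : patchWeight U α h₀ φ x y ≤ 1 := by
  refine Real.exp_le_one_iff.2 (div_nonpos_of_nonpos_of_nonneg ?_ (by positivity))
  exact neg_nonpos.2 (integral_nonneg fun t => mul_nonneg (gaussKernel_nonneg t) (by positivity))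

/-- On a bounded set, the patch similarities of a locally square-integrable image are bounded
away from zero. -/
theorem exists_pos_le_patchWeight (hU : MeasurableSet U) (hUb : Bornology.IsBounded U)
    (hφ : ∀ R : ℝ, MemLp φ 2 (volume.restrict (Metric.ball 0 R)))
    {Ω : Set Plane} (hΩb : Bornology.IsBounded Ω) :
    ∃ c, 0 < c ∧ ∀ x ∈ Ω, ∀ y ∈ Ω, c ≤ patchWeight U α h₀ φ x y := by
  obtain ⟨R₁, hR₁⟩ := hΩb.exists_norm_le
  obtain ⟨R₂, hR₂⟩ := hUb.exists_norm_le
  -- An open ball containing every x - t with `x ∈ Ω`, `t ∈ U`; the extra 1 makes the inequality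
  -- strict.
  set B : Set Plane := Metric.ball 0 (R₁ + R₂ + 1)
  set ρ : Plane → ℝ := B.indicator fun z => ‖φ z‖ ^ 2
  have hρ : Integrable ρ := by
    rw [integrable_indicator_iff measurableSet_ball]
    exact (memLp_two_iff_integrable_sq_norm (hφ _).1).1 (hφ _)
  have hρ0 : ∀ z, 0 ≤ ρ z := fun z => Set.indicator_nonneg (fun _ _ => sq_nonneg _) z
  have hρφ : ∀ x ∈ Ω, ∀ t ∈ U, ‖φ (x - t)‖ ^ 2 = ρ (x - t) := by
    intro x hx t ht
    have hmem : x - t ∈ B := by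
      rw [mem_ball_zero_iff]
      have := norm_sub_le x t
      have := hR₁ x hx
      have := hR₂ t ht
      linarith
    exact (Set.indicator_of_mem hmem fun z => ‖φ z‖ ^ 2).symm
  set M : ℝ := (2 * Real.pi * α ^ 2)⁻¹
  have hM : 0 ≤ M := by positivity
  -- `M` bounds the Gaussian; 4 comes from |a - b|² ≤ 2|a|² + 2|b|² and two translates of `ρ` with
  -- equal integrals.
  refine ⟨Real.exp (-(M * (4 * ∫ z, ρ z)) / (2 * h₀ ^ 2)), Real.exp_pos _, fun x hx y hy => ?_⟩
  refine Real.exp_le_exp.2 ?_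
  gcongr
  have hint : ∀ z, Integrable fun t => ρ (z - t) := fun z => hρ.comp_sub_left z
  have hmaj : Integrable fun t => M * (2 * ρ (x - t) + 2 * ρ (y - t)) :=
    (((hint x).const_mul 2).add ((hint y).const_mul 2)).const_mul M
  calc ∫ t in U, gaussKernel α t * ‖φ (x - t) - φ (y - t)‖ ^ 2
      ≤ ∫ t in U, M * (2 * ρ (x - t) + 2 * ρ (y - t)) := by
        refine integral_mono_of_nonneg (Eventually.of_forall fun t =>
          mul_nonneg (gaussKernel_nonneg t) (by positivity)) hmaj.integrableOn ?_
        filter_upwards [ae_restrict_mem hU] with t ht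
        refine mul_le_mul (gaussKernel_le t) ?_ (by positivity) hM
        rw [← hρφ x hx t ht, ← hρφ y hy t ht]
        have h1 := norm_sub_le (φ (x - t)) (φ (y - t))
        have h2 : ‖φ (x - t) - φ (y - t)‖ ^ 2 ≤ (‖φ (x - t)‖ + ‖φ (y - t)‖) ^ 2 := by gcongr
        have h3 := sq_nonneg (‖φ (x - t)‖ - ‖φ (y - t)‖)
        linarith
    _ ≤ ∫ t, M * (2 * ρ (x - t) + 2 * ρ (y - t)) := by
        refine setIntegral_le_integral hmaj (Eventually.of_forall fun t => ?_)
        have := hρ0 (x - t)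
        have := hρ0 (y - t)
        positivity
    _ = M * (4 * ∫ z, ρ z) := by
        rw [integral_const_mul, integral_add ((hint x).const_mul 2) ((hint y).const_mul 2),
          integral_const_mul, integral_const_mul, integral_sub_left_eq_self,
          integral_sub_left_eq_self]
        ring

end Weights

theorem aestronglyMeasurable_of_forall_ball {F : Type*} [NormedAddCommGroup F] {g : Plane → F}
    (hg : ∀ R : ℝ, AEStronglyMeasurable g (volume.restrict (Metric.ball 0 R))) :
    AEStronglyMeasurable g volume := by
  rw [← Measure.restrict_univ (μ := (volume : Measure Plane)), ← Metric.iUnion_ball_nat 0,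
    aestronglyMeasurable_iUnion_iff]
  exact fun n => hg n

/-- The properties of the similarity weights on which the analysis depends. -/
structure IsSimilarityWeight (Ω : Set Plane) (w : Plane → Plane → ℝ) : Prop where
  measurable : Measurable (Function.uncurry w)
  le_one : ∀ x y, w x y ≤ 1
  exists_pos_le : ∃ c, 0 < c ∧ ∀ x ∈ Ω, ∀ y ∈ Ω, c ≤ w x y

section Weights

variable {Ω U : Set Plane} {α h₀ : ℝ} {g : Plane → RGB}

theorem isSimilarityWeight_patchWeight {F : Type*} [NormedAddCommGroup F] {φ : Plane → F}
    (hU : MeasurableSet U) (hUb : Bornology.IsBounded U) (hΩb : Bornology.IsBounded Ω)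
    (hφ : ∀ R : ℝ, MemLp φ 2 (volume.restrict (Metric.ball 0 R))) :
    IsSimilarityWeight Ω (patchWeight U α h₀ φ) where
  measurable := measurable_patchWeight (aestronglyMeasurable_of_forall_ball fun R => (hφ R).1)
  le_one := patchWeight_le_one
  exists_pos_le := exists_pos_le_patchWeight hU hUb hφ hΩb

theorem isSimilarityWeight_weightSat (hU : MeasurableSet U) (hUb : Bornology.IsBounded U)
    (hΩb : Bornology.IsBounded Ω) (hg : ∀ R : ℝ, MemLp g 2 (volume.restrict (Metric.ball 0 R))) :
    IsSimilarityWeight Ω (weightSat U α h₀ g) :=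
  isSimilarityWeight_patchWeight (φ := fun x => sat (g x)) hU hUb hΩb fun R =>
    (hg R).mono (continuous_sat.comp_aestronglyMeasurable (hg R).1)
      (Eventually.of_forall fun _ => norm_sat_le _)

theorem isSimilarityWeight_weightVal (hU : MeasurableSet U) (hUb : Bornology.IsBounded U)
    (hΩb : Bornology.IsBounded Ω) (hg : ∀ R : ℝ, MemLp g 2 (volume.restrict (Metric.ball 0 R))) :
    IsSimilarityWeight Ω (weightVal U α h₀ g) :=
  isSimilarityWeight_patchWeight (φ := fun x => val (g x)) hU hUb hΩb fun R =>
    (hg R).mono (continuous_val.comp_aestronglyMeasurable (hg R).1)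
      (Eventually.of_forall fun _ => norm_val_le _)

end Weights

/-! ### The regularizer and the identification of SVS-NLBV with L² -/

section Regularizer

variable {Ω : Set Plane} {ωs ωv : Plane → Plane → ℝ} {μ : ℝ} {u v : Plane → RGB}

theorem lintegral_gradSatNorm : ∫⁻ x in Ω, gradSatNorm Ω ωs u x
    = nonlocalTV (volume.restrict Ω) ωs (sat ∘ u) := by
  simp only [nonlocalTV, eLpNorm_two_eq_lintegral_rpow]
  rfl

theorem lintegral_gradValNorm : ∫⁻ x in Ω, gradValNorm Ω ωv u x
    = nonlocalTV (volume.restrict Ω) ωv (val ∘ u) := by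
  simp only [nonlocalTV, eLpNorm_two_eq_lintegral_rpow]
  rfl

theorem svsnltv_eq : svsnltv Ω ωs ωv μ u = nonlocalTV (volume.restrict Ω) ωs (sat ∘ u)
    + ENNReal.ofReal μ * nonlocalTV (volume.restrict Ω) ωv (val ∘ u) := by
  rw [svsnltv, lintegral_gradSatNorm, lintegral_gradValNorm]

theorem mem_SVSNLBV : u ∈ SVSNLBV Ω ωs ωv ↔ IntegrableOn u Ω ∧ svsnltv Ω ωs ωv 1 u < ∞ := by
  simp [SVSNLBV, svsnltv]

theorem svsnltv_congr_ae (h : u =ᵐ[volume.restrict Ω] v) :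
    svsnltv Ω ωs ωv μ u = svsnltv Ω ωs ωv μ v := by
  rw [svsnltv_eq, svsnltv_eq, nonlocalTV_congr_ae (h.fun_comp sat),
    nonlocalTV_congr_ae (h.fun_comp val)]

theorem svsnltv_const (a : RGB) : svsnltv Ω ωs ωv μ (fun _ => a) = 0 := by
  rw [svsnltv_eq, Function.comp_def, Function.comp_def, nonlocalTV_const, nonlocalTV_const]
  simp

theorem svsnltv_smul (c : ℝ) :
    svsnltv Ω ωs ωv μ (c • u) = ‖c‖ₑ * svsnltv Ω ωs ωv μ u := by
  have hs : sat ∘ (c • u) = c • (sat ∘ u) := funext fun x => sat_smul c (u x)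
  have hv : val ∘ (c • u) = c • (val ∘ u) := funext fun x => val_smul c (u x)
  rw [svsnltv_eq, svsnltv_eq, hs, hv, nonlocalTV_smul, nonlocalTV_smul]
  ring

theorem svsnltv_add_le (hs : IsSimilarityWeight Ω ωs) (hv : IsSimilarityWeight Ω ωv)
    (hu : AEStronglyMeasurable u (volume.restrict Ω))
    (hv' : AEStronglyMeasurable v (volume.restrict Ω)) :
    svsnltv Ω ωs ωv μ (u + v) ≤ svsnltv Ω ωs ωv μ u + svsnltv Ω ωs ωv μ v := by
  have h1 : sat ∘ (u + v) = sat ∘ u + sat ∘ v := funext fun x => sat_add (u x) (v x)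
  have h2 : val ∘ (u + v) = val ∘ u + val ∘ v := funext fun x => val_add (u x) (v x)
  rw [svsnltv_eq, svsnltv_eq, svsnltv_eq, h1, h2, add_add_add_comm, ← mul_add]
  gcongr
  · exact nonlocalTV_add_le hs.measurable (continuous_sat.comp_aestronglyMeasurable hu)
      (continuous_sat.comp_aestronglyMeasurable hv')
  · exact nonlocalTV_add_le hv.measurable (continuous_val.comp_aestronglyMeasurable hu)
      (continuous_val.comp_aestronglyMeasurable hv')

theorem exists_svsnltv_le (hΩb : Bornology.IsBounded Ω) (hs : IsSimilarityWeight Ω ωs)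
    (hv : IsSimilarityWeight Ω ωv) (μ : ℝ) : ∃ C : ℝ≥0∞, C ≠ ∞ ∧
      ∀ u, AEStronglyMeasurable u (volume.restrict Ω) →
        svsnltv Ω ωs ωv μ u ≤ C * eLpNorm u 2 (volume.restrict Ω) := by
  have : IsFiniteMeasure (volume.restrict Ω) := ⟨by simpa using hΩb.measure_lt_top⟩
  set m := volume.restrict Ω Set.univ
  have hm : m ≠ ∞ := measure_ne_top _ _
  refine ⟨2 * m + ENNReal.ofReal μ * (2 * m), by finiteness, fun u hu => ?_⟩
  rw [svsnltv_eq, add_mul, mul_assoc (ENNReal.ofReal μ)]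
  gcongr
  · refine (nonlocalTV_le hs.le_one (continuous_sat.comp_aestronglyMeasurable hu)).trans ?_
    gcongr
    exact eLpNorm_mono fun x => norm_sat_le _
  · refine (nonlocalTV_le hv.le_one (continuous_val.comp_aestronglyMeasurable hu)).trans ?_
    gcongr
    exact eLpNorm_mono fun x => norm_val_le _

theorem IsSimilarityWeight.exists_eLpNorm_sub_const_le {w : Plane → Plane → ℝ}
    (hw : IsSimilarityWeight Ω w) (hΩ : MeasurableSet Ω) (hΩb : Bornology.IsBounded Ω)
    (h0 : volume Ω ≠ 0) (F : Type*) [NormedAddCommGroup F] [NormedSpace ℝ F] :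
    ∃ C : ℝ≥0∞, C ≠ ∞ ∧ ∀ h : Plane → F, AEStronglyMeasurable h (volume.restrict Ω) →
      ∃ a, eLpNorm (fun y => h y - a) 2 (volume.restrict Ω)
        ≤ C * nonlocalTV (volume.restrict Ω) w h := by
  have : IsFiniteMeasure (volume.restrict Ω) := ⟨by simpa using hΩb.measure_lt_top⟩
  have h0' : volume.restrict Ω ≠ 0 := by simpa [Measure.restrict_eq_zero] using h0
  obtain ⟨c, hc, hcw⟩ := hw.exists_pos_le
  refine ⟨ENNReal.ofReal (√c)⁻¹ / volume.restrict Ω Set.univ,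
    ENNReal.div_ne_top ENNReal.ofReal_ne_top (by simpa using h0), fun h hh => ?_⟩
  obtain ⟨a, ha⟩ := exists_eLpNorm_sub_const_le_nonlocalTV (w := w) h0' hc (by
    filter_upwards [ae_restrict_mem hΩ] with x hx
    filter_upwards [ae_restrict_mem hΩ] with y hy using hcw x hx y hy) hh
  refine ⟨a, ha.trans_eq ?_⟩
  rw [div_eq_mul_inv, div_eq_mul_inv]
  ring

theorem exists_eLpNorm_sub_const_le_svsnltv (hΩ : MeasurableSet Ω)
    (hΩb : Bornology.IsBounded Ω) (h0 : volume Ω ≠ 0) (hs : IsSimilarityWeight Ω ωs)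
    (hv : IsSimilarityWeight Ω ωv) (hμ : 0 < μ) : ∃ C : ℝ≥0∞, C ≠ ∞ ∧
      ∀ u, AEStronglyMeasurable u (volume.restrict Ω) →
        ∃ a, eLpNorm (fun y => u y - a) 2 (volume.restrict Ω) ≤ C * svsnltv Ω ωs ωv μ u := by
  obtain ⟨Cs, hCs, hs'⟩ := hs.exists_eLpNorm_sub_const_le hΩ hΩb h0 (EuclideanSpace ℝ (Fin 2))
  obtain ⟨Cv, hCv, hv'⟩ := hv.exists_eLpNorm_sub_const_le hΩ hΩb h0 ℝ
  refine ⟨Cs + Cv * ENNReal.ofReal μ⁻¹, by finiteness, fun u hu => ?_⟩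
  have hsu := continuous_sat.comp_aestronglyMeasurable hu
  have hvu := continuous_val.comp_aestronglyMeasurable hu
  obtain ⟨s, hs⟩ := hs' _ hsu
  obtain ⟨v, hv⟩ := hv' _ hvu
  obtain ⟨a, rfl, rfl⟩ := exists_sat_eq_val_eq s v
  refine ⟨a, ?_⟩
  have hle : eLpNorm (fun y => u y - a) 2 (volume.restrict Ω)
      ≤ eLpNorm (fun y => sat (u y) - sat a) 2 (volume.restrict Ω)
        + eLpNorm (fun y => val (u y) - val a) 2 (volume.restrict Ω) := by
    have h1 := (hsu.sub (aestronglyMeasurable_const (b := sat a))).norm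
    have h2 := (hvu.sub (aestronglyMeasurable_const (b := val a))).norm
    rw [← eLpNorm_norm fun y => sat (u y) - sat a, ← eLpNorm_norm fun y => val (u y) - val a]
    refine le_trans (eLpNorm_mono_real fun y => ?_) (eLpNorm_add_le h1 h2 one_le_two)
    have := norm_le_norm_sat_add_norm_val (u y - a)
    rwa [sat_sub, val_sub] at this
  refine hle.trans ((add_le_add hs hv).trans ?_)
  rw [add_mul, mul_assoc Cv]
  gcongr
  · rw [svsnltv_eq]; exact le_self_add
  · have hμ' : ENNReal.ofReal μ ≠ 0 := by simpa using hμ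
    rw [ENNReal.ofReal_inv_of_pos hμ, ← ENNReal.div_eq_inv_mul,
      ENNReal.le_div_iff_mul_le (Or.inl hμ') (Or.inl ENNReal.ofReal_ne_top), mul_comm, svsnltv_eq]
    exact le_add_self

/-- Finite variation puts `u` within finite L² distance of a constant, which is itself in L² as `Ω`
has finite measure; the converse is the upper bound on the regularizer. -/
theorem mem_SVSNLBV_iff_memLp (hΩ : MeasurableSet Ω) (hΩb : Bornology.IsBounded Ω)
    (h0 : volume Ω ≠ 0) (hs : IsSimilarityWeight Ω ωs) (hv : IsSimilarityWeight Ω ωv) :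
    u ∈ SVSNLBV Ω ωs ωv ↔ MemLp u 2 (volume.restrict Ω) := by
  have : IsFiniteMeasure (volume.restrict Ω) := ⟨by simpa using hΩb.measure_lt_top⟩
  rw [mem_SVSNLBV]
  constructor
  · rintro ⟨hu, hfin⟩
    obtain ⟨C, hC, h⟩ := exists_eLpNorm_sub_const_le_svsnltv hΩ hΩb h0 hs hv one_pos
    obtain ⟨a, ha⟩ := h u hu.1
    have h1 : MemLp (fun y => u y - a) 2 (volume.restrict Ω) :=
      ⟨hu.1.sub aestronglyMeasurable_const, ha.trans_lt (by finiteness)⟩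
    exact (h1.add (memLp_const a)).ae_eq (Eventually.of_forall fun y => by simp)
  · intro hu
    obtain ⟨C, hC, h⟩ := exists_svsnltv_le hΩb hs hv 1
    have := hu.2
    exact ⟨hu.integrable one_le_two, (h u hu.1).trans_lt (by finiteness)⟩

/-- The regularizer as a continuous seminorm on `L²(Ω; ℝ³)`. -/
theorem exists_seminorm_svsnltv (hΩb : Bornology.IsBounded Ω) (hs : IsSimilarityWeight Ω ωs)
    (hv : IsSimilarityWeight Ω ωv) (μ : ℝ) :
    ∃ J : Seminorm ℝ (Lp RGB 2 (volume.restrict Ω)), Continuous J ∧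
      ∀ u : Lp RGB 2 (volume.restrict Ω), svsnltv Ω ωs ωv μ u = ENNReal.ofReal (J u) := by
  obtain ⟨C, hC, hle⟩ := exists_svsnltv_le hΩb hs hv μ
  have hle' : ∀ u : Lp RGB 2 (volume.restrict Ω),
      svsnltv Ω ωs ωv μ u ≤ C * eLpNorm u 2 (volume.restrict Ω) :=
    fun u => hle u (Lp.aestronglyMeasurable u)
  have hfin : ∀ u : Lp RGB 2 (volume.restrict Ω), svsnltv Ω ωs ωv μ u ≠ ∞ := fun u =>
    ne_top_of_le_ne_top (ENNReal.mul_ne_top hC (Lp.eLpNorm_ne_top u)) (hle' u)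
  let J : Seminorm ℝ (Lp RGB 2 (volume.restrict Ω)) :=
    Seminorm.of (fun u => (svsnltv Ω ωs ωv μ u).toReal)
      (fun u v => by
        rw [svsnltv_congr_ae (Lp.coeFn_add u v), ← ENNReal.toReal_add (hfin u) (hfin v)]
        exact ENNReal.toReal_mono (ENNReal.add_ne_top.2 ⟨hfin u, hfin v⟩)
          (svsnltv_add_le hs hv (Lp.aestronglyMeasurable u) (Lp.aestronglyMeasurable v)))
      (fun c u => by
        rw [svsnltv_congr_ae (Lp.coeFn_smul c u), svsnltv_smul, ENNReal.toReal_mul,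
          toReal_enorm])
  refine ⟨J, ?_, fun u => (ENNReal.ofReal_toReal (hfin u)).symm⟩
  refine Seminorm.continuous_of_le
    (q := C.toNNReal • normSeminorm ℝ (Lp RGB 2 (volume.restrict Ω))) ?_ fun u => ?_
  · exact continuous_norm.const_smul C.toNNReal
  · have := ENNReal.toReal_mono (ENNReal.mul_ne_top hC (Lp.eLpNorm_ne_top u)) (hle' u)
    rw [ENNReal.toReal_mul, ← Lp.norm_def] at this
    exact this

end Regularizer

/-! ### The blur between Lebesgue spaces on a bounded domain -/

section Fidelity

variable {Ω : Set Plane}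

theorem memLp_blur {p : ℝ≥0∞} (hp : p ≤ 2) (hΩ : MeasurableSet Ω) (hΩb : Bornology.IsBounded Ω)
    (K : SignedMeasure Plane) {u : Plane → RGB} (hu : MemLp u 2 (volume.restrict Ω)) :
    MemLp (blur Ω K u) p (volume.restrict Ω) := by
  have : IsFiniteMeasure (volume.restrict Ω) := ⟨by simpa using hΩb.measure_lt_top⟩
  have h2 : MemLp (blur Ω K u) 2 volume := by
    refine ⟨aestronglyMeasurable_blur hΩ hu.1, (eLpNorm_blur_le hΩ hu.1).trans_lt ?_⟩
    have := hu.2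
    finiteness
  exact (h2.restrict Ω).mono_exponent hp

/-- The blurring operator as a continuous linear map from `L²(Ω; ℝ³)` to `Lᵖ(Ω; ℝ³)`. -/
theorem exists_continuousLinearMap_blur {p : ℝ≥0∞} [Fact (1 ≤ p)] (hp : p ≤ 2)
    (hΩ : MeasurableSet Ω) (hΩb : Bornology.IsBounded Ω) (K : SignedMeasure Plane) :
    ∃ T : Lp RGB 2 (volume.restrict Ω) →L[ℝ] Lp RGB p (volume.restrict Ω),
      ∀ u, T u =ᵐ[volume.restrict Ω] blur Ω K u := by
  have : IsFiniteMeasure (volume.restrict Ω) := ⟨by simpa using hΩb.measure_lt_top⟩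
  have hmem : ∀ u : Lp RGB 2 (volume.restrict Ω), MemLp (blur Ω K u) p (volume.restrict Ω) :=
    fun u => memLp_blur hp hΩ hΩb K (Lp.memLp u)
  let T₀ : Lp RGB 2 (volume.restrict Ω) →ₗ[ℝ] Lp RGB p (volume.restrict Ω) :=
    { toFun := fun u => (hmem u).toLp _
      map_add' := fun u v => by
        rw [← MemLp.toLp_add]
        refine MemLp.toLp_congr _ _ (ae_restrict_of_ae ?_)
        exact (blur_congr_ae hΩ (Lp.coeFn_add u v)).trans
          (blur_add_ae hΩ (Lp.memLp u) (Lp.memLp v))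
      map_smul' := fun c u => by
        rw [RingHom.id_apply, ← MemLp.toLp_const_smul]
        refine MemLp.toLp_congr _ _ (ae_restrict_of_ae ?_)
        rw [← blur_smul]
        exact blur_congr_ae hΩ (Lp.coeFn_smul c u) }
  set A : ℝ≥0∞ := K.toJordanDecomposition.posPart Set.univ
    + K.toJordanDecomposition.negPart Set.univ
  -- The Hölder factor for passing from L² to Lᵖ on `Ω`.
  set B : ℝ≥0∞ := volume.restrict Ω Set.univ ^ (1 / p.toReal - 1 / (2 : ℝ≥0∞).toReal)
  have hB : B ≠ ∞ := by
    refine ENNReal.rpow_ne_top_of_nonneg ?_ (measure_ne_top _ _)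
    have h1 : 0 < p.toReal := ENNReal.toReal_pos (zero_lt_one.trans_le Fact.out).ne'
      (ne_top_of_le_ne_top ENNReal.ofNat_ne_top hp)
    have h2 : p.toReal ≤ (2 : ℝ≥0∞).toReal := ENNReal.toReal_mono ENNReal.ofNat_ne_top hp
    have := one_div_le_one_div_of_le h1 h2
    linarith
  refine ⟨T₀.mkContinuous (A * B).toReal fun u => ?_, fun u => MemLp.coeFn_toLp (hmem u)⟩
  change ‖(hmem u).toLp _‖ ≤ _
  rw [Lp.norm_toLp, Lp.norm_def, ← ENNReal.toReal_mul]
  refine ENNReal.toReal_mono (ENNReal.mul_ne_top (by finiteness) (Lp.eLpNorm_ne_top u)) ?_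
  have h := aestronglyMeasurable_blur (K := K) hΩ (Lp.aestronglyMeasurable u)
  calc eLpNorm (blur Ω K u) p (volume.restrict Ω)
      ≤ eLpNorm (blur Ω K u) 2 (volume.restrict Ω) * B :=
        eLpNorm_le_eLpNorm_mul_rpow_measure_univ hp h.restrict
    _ ≤ A * eLpNorm u 2 (volume.restrict Ω) * B := by
        gcongr
        exact (eLpNorm_restrict_le _ _ _ _).trans (eLpNorm_blur_le hΩ (Lp.aestronglyMeasurable u))
    _ = _ := by ring

end Fidelity

/-! ### Existence and uniqueness of minimizers -/

section Minimizers

variable {Ω : Set Plane} {ωs ωv : Plane → Plane → ℝ} {μ lam : ℝ} {K : SignedMeasure Plane}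
  {f u v : Plane → RGB}

/-- The energy with fidelity `(λ / 2) ‖K * u - f‖ₚ ^ k`. -/
noncomputable def energyLp (p : ℝ≥0∞) (k : ℕ) (Ω : Set Plane) (ωs ωv : Plane → Plane → ℝ)
    (μ lam : ℝ) (K : SignedMeasure Plane) (f u : Plane → RGB) : ℝ≥0∞ :=
  svsnltv Ω ωs ωv μ u
    + ENNReal.ofReal (lam / 2) * eLpNorm (blur Ω K u - f) p (volume.restrict Ω) ^ k

theorem energyL2_eq_energyLp :
    energyL2 Ω ωs ωv μ lam K f = energyLp 2 2 Ω ωs ωv μ lam K f := by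
  ext u
  rw [energyL2, energyLp, eLpNorm_two_sq_eq_lintegral]
  rfl

theorem energyL1_eq_energyLp :
    energyL1 Ω ωs ωv μ lam K f = energyLp 1 1 Ω ωs ωv μ lam K f := by
  ext u
  rw [energyL1, energyLp, pow_one, eLpNorm_one_eq_lintegral_enorm]
  rfl

theorem energyLp_congr_ae {p : ℝ≥0∞} {k : ℕ} (hΩ : MeasurableSet Ω)
    (h : u =ᵐ[volume.restrict Ω] v) :
    energyLp p k Ω ωs ωv μ lam K f u = energyLp p k Ω ωs ωv μ lam K f v := by
  have hb : blur Ω K u =ᵐ[volume.restrict Ω] blur Ω K v := ae_restrict_of_ae (blur_congr_ae hΩ h)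
  rw [energyLp, energyLp, svsnltv_congr_ae h, eLpNorm_congr_ae (hb.sub (EventuallyEq.refl _ f))]

/-- On `L²(Ω; ℝ³)`, the energy is a continuous seminorm plus a power of the residual of a
continuous linear map. -/
theorem exists_energyLp_eq {p : ℝ≥0∞} [Fact (1 ≤ p)] (hp : p ≤ 2) (k : ℕ) (hΩ : MeasurableSet Ω)
    (hΩb : Bornology.IsBounded Ω) (hs : IsSimilarityWeight Ω ωs) (hv : IsSimilarityWeight Ω ωv)
    (hlam : 0 < lam) (K : SignedMeasure Plane) (hf : MemLp f p (volume.restrict Ω)) :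
    ∃ (J : Seminorm ℝ (Lp RGB 2 (volume.restrict Ω)))
      (T : Lp RGB 2 (volume.restrict Ω) →L[ℝ] Lp RGB p (volume.restrict Ω)),
      Continuous J ∧ (∀ u : Lp RGB 2 (volume.restrict Ω), svsnltv Ω ωs ωv μ u = ENNReal.ofReal (J u)) ∧
      (∀ u : Lp RGB 2 (volume.restrict Ω), T u =ᵐ[volume.restrict Ω] blur Ω K u) ∧
      ∀ u : Lp RGB 2 (volume.restrict Ω), energyLp p k Ω ωs ωv μ lam K f u
        = ENNReal.ofReal (J u + lam / 2 * ‖T u - hf.toLp f‖ ^ k) := by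
  obtain ⟨J, hJ, hJu⟩ := exists_seminorm_svsnltv hΩb hs hv μ
  obtain ⟨T, hT⟩ := exists_continuousLinearMap_blur hp hΩ hΩb K
  refine ⟨J, T, hJ, hJu, hT, fun u => ?_⟩
  have hlam' : 0 ≤ lam / 2 := by positivity
  have hnorm : eLpNorm (blur Ω K u - f) p (volume.restrict Ω)
      = ENNReal.ofReal ‖T u - hf.toLp f‖ := by
    rw [Lp.norm_def, ENNReal.ofReal_toReal (Lp.eLpNorm_ne_top _)]
    exact (eLpNorm_congr_ae ((Lp.coeFn_sub _ _).trans ((hT u).sub hf.coeFn_toLp))).symm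
  rw [energyLp, hJu, hnorm, ENNReal.ofReal_add (apply_nonneg J u) (by positivity),
    ENNReal.ofReal_mul hlam', ENNReal.ofReal_pow (norm_nonneg _)]

theorem exists_isMinimizer_energyLp {p : ℝ≥0∞} [Fact (1 ≤ p)] (hp : p ≤ 2) {k : ℕ} (hk : k ≠ 0)
    (hΩ : MeasurableSet Ω) (hΩb : Bornology.IsBounded Ω) (hs : IsSimilarityWeight Ω ωs)
    (hv : IsSimilarityWeight Ω ωv) (hμ : 0 < μ) (hlam : 0 < lam) (K : SignedMeasure Plane)
    (hf : MemLp f p (volume.restrict Ω)) :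
    ∃ u, IsMinimizer (SVSNLBV Ω ωs ωv) (energyLp p k Ω ωs ωv μ lam K f) u := by
  have : IsFiniteMeasure (volume.restrict Ω) := ⟨by simpa using hΩb.measure_lt_top⟩
  -- The Poincaré constant divides by the measure of `Ω`; on a null domain every energy is zero.
  rcases eq_or_ne (volume Ω) 0 with h0 | h0
  · have hν : volume.restrict Ω = 0 := Measure.restrict_eq_zero.2 h0
    refine ⟨0, mem_SVSNLBV.2 ⟨integrableOn_zero, ?_⟩, fun v _ => ?_⟩
    · simp [svsnltv_eq, nonlocalTV, hν]
    · simp [energyLp, svsnltv_eq, nonlocalTV, hν, hk]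
  obtain ⟨J, T, hJ, hJu, -, hE⟩ := exists_energyLp_eq (μ := μ) hp k hΩ hΩb hs hv hlam K hf
  obtain ⟨C, hC, hpoincare⟩ := exists_eLpNorm_sub_const_le_svsnltv hΩ hΩb h0 hs hv hμ
  -- The range of `ι`, the constant colours, is the finite-dimensional subspace on which `J`
  -- vanishes.
  let ι := Lp.constL (E := RGB) 2 (volume.restrict Ω) ℝ
  have hι : ∀ a, ι a =ᵐ[volume.restrict Ω] fun _ => a := fun a => Lp.coeFn_const 2 _ a
  obtain ⟨u, hu⟩ := exists_forall_seminorm_add_norm_pow_le J hJ (LinearMap.range (ι : RGB →ₗ[ℝ] _))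
    (C := C.toReal) (by
      rintro _ ⟨a, rfl⟩
      have h : svsnltv Ω ωs ωv μ (ι a) = 0 := by
        exact (svsnltv_congr_ae (hι a)).trans (svsnltv_const a)
      rw [hJu, ENNReal.ofReal_eq_zero] at h
      exact le_antisymm h (apply_nonneg J _))
    (fun u => by
      obtain ⟨a, ha⟩ := hpoincare u (Lp.aestronglyMeasurable u)
      refine ⟨ι a, ⟨a, rfl⟩, ?_⟩
      rw [hJu] at ha
      have h := ENNReal.toReal_mono (by finiteness) ha
      rw [ENNReal.toReal_mul, ENNReal.toReal_ofReal (apply_nonneg J u)] at h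
      refine le_of_eq_of_le ?_ h
      rw [Lp.norm_def]
      congr 1
      exact eLpNorm_congr_ae ((Lp.coeFn_sub _ _).trans
        ((EventuallyEq.refl _ _).sub (hι a))))
    T (hf.toLp f) (half_pos hlam) hk
  refine ⟨u, (mem_SVSNLBV_iff_memLp hΩ hΩb h0 hs hv).2 (Lp.memLp u), fun v hv' => ?_⟩
  have hv2 := (mem_SVSNLBV_iff_memLp hΩ hΩb h0 hs hv).1 hv'
  rw [← energyLp_congr_ae hΩ hv2.coeFn_toLp, hE, hE]
  exact ENNReal.ofReal_le_ofReal (hu _)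

theorem IsMinimizer.blur_ae_eq (hΩ : MeasurableSet Ω) (hΩb : Bornology.IsBounded Ω)
    (hs : IsSimilarityWeight Ω ωs) (hv : IsSimilarityWeight Ω ωv) (hlam : 0 < lam)
    (hf : MemLp f 2 (volume.restrict Ω))
    (hu : IsMinimizer (SVSNLBV Ω ωs ωv) (energyLp 2 2 Ω ωs ωv μ lam K f) u)
    (hv' : IsMinimizer (SVSNLBV Ω ωs ωv) (energyLp 2 2 Ω ωs ωv μ lam K f) v) :
    blur Ω K u =ᵐ[volume.restrict Ω] blur Ω K v := by
  rcases eq_or_ne (volume Ω) 0 with h0 | h0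
  · rw [Measure.restrict_eq_zero.2 h0]
    simp [EventuallyEq]
  have hmem : ∀ {w}, w ∈ SVSNLBV Ω ωs ωv ↔ MemLp w 2 (volume.restrict Ω) :=
    mem_SVSNLBV_iff_memLp hΩ hΩb h0 hs hv
  obtain ⟨J, T, -, -, hT, hE⟩ := exists_energyLp_eq (μ := μ) le_rfl 2 hΩ hΩb hs hv hlam K hf
  have hmin : ∀ {w} (hw : IsMinimizer (SVSNLBV Ω ωs ωv) (energyLp 2 2 Ω ωs ωv μ lam K f) w) z,
      J ((hmem.1 hw.1).toLp w) + lam / 2 * ‖T ((hmem.1 hw.1).toLp w) - hf.toLp f‖ ^ 2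
        ≤ J z + lam / 2 * ‖T z - hf.toLp f‖ ^ 2 := by
    intro w hw z
    have h := hw.2 z (hmem.2 (Lp.memLp z))
    rw [← energyLp_congr_ae hΩ (hmem.1 hw.1).coeFn_toLp, hE, hE] at h
    have := apply_nonneg J z
    exact (ENNReal.ofReal_le_ofReal_iff (by positivity)).1 h
  have heq := map_eq_of_forall_seminorm_add_norm_sq_le J T.toLinearMap (hf.toLp f)
    (half_pos hlam) (hmin hu) (hmin hv')
  have hblur : ∀ {w} (hw : MemLp w 2 (volume.restrict Ω)),
      T (hw.toLp w) =ᵐ[volume.restrict Ω] blur Ω K w := fun hw =>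
    (hT _).trans (ae_restrict_of_ae (blur_congr_ae hΩ hw.coeFn_toLp))
  refine (hblur (hmem.1 hu.1)).symm.trans (EventuallyEq.trans ?_ (hblur (hmem.1 hv'.1)))
  exact EventuallyEq.of_eq
    (congrArg (fun z : Lp RGB 2 (volume.restrict Ω) => (z : Plane → RGB)) heq)

end Minimizers

end SVSNLTV

theorem mainTheorem1
    (Ω : Set SVSNLTV.Plane) (hΩ : IsOpen Ω) (hΩb : Bornology.IsBounded Ω)
    (U : Set SVSNLTV.Plane) (hU : MeasurableSet U) (hUb : Bornology.IsBounded U)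
    (α h₀ μ lam : ℝ) (hα : 0 < α) (hh₀ : 0 < h₀) (hμ : 0 < μ) (hlam : 0 < lam)
    (g : SVSNLTV.Plane → SVSNLTV.RGB)
    (hg : ∀ R : ℝ, MemLp g 2 (volume.restrict (Metric.ball 0 R)))
    (ωs ωv : SVSNLTV.Plane → SVSNLTV.Plane → ℝ)
    (hωs : ωs = SVSNLTV.weightSat U α h₀ g) (hωv : ωv = SVSNLTV.weightVal U α h₀ g)
    (K : SignedMeasure SVSNLTV.Plane) (f : SVSNLTV.Plane → SVSNLTV.RGB) :
    (MemLp f 2 (volume.restrict Ω) →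
      (∃ u, SVSNLTV.IsMinimizer (SVSNLTV.SVSNLBV Ω ωs ωv)
        (SVSNLTV.energyL2 Ω ωs ωv μ lam K f) u) ∧
      ((∀ u ∈ SVSNLTV.SVSNLBV Ω ωs ωv, ∀ v ∈ SVSNLTV.SVSNLBV Ω ωs ωv,
          SVSNLTV.blur Ω K u =ᵐ[volume.restrict Ω] SVSNLTV.blur Ω K v →
          u =ᵐ[volume.restrict Ω] v) →
        ∀ u v,
          SVSNLTV.IsMinimizer (SVSNLTV.SVSNLBV Ω ωs ωv)
            (SVSNLTV.energyL2 Ω ωs ωv μ lam K f) u →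
          SVSNLTV.IsMinimizer (SVSNLTV.SVSNLBV Ω ωs ωv)
            (SVSNLTV.energyL2 Ω ωs ωv μ lam K f) v →
          u =ᵐ[volume.restrict Ω] v)) ∧
    (MemLp f 1 (volume.restrict Ω) →
      ∃ u, SVSNLTV.IsMinimizer (SVSNLTV.SVSNLBV Ω ωs ωv)
        (SVSNLTV.energyL1 Ω ωs ωv μ lam K f) u) := by
  have hs : SVSNLTV.IsSimilarityWeight Ω ωs :=
    hωs ▸ SVSNLTV.isSimilarityWeight_weightSat hU hUb hΩb hg
  have hv : SVSNLTV.IsSimilarityWeight Ω ωv :=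
    hωv ▸ SVSNLTV.isSimilarityWeight_weightVal hU hUb hΩb hg
  have hΩm := hΩ.measurableSet
  rw [SVSNLTV.energyL2_eq_energyLp, SVSNLTV.energyL1_eq_energyLp]
  refine ⟨fun hf => ⟨?_, fun hinj u v hu hv' => ?_⟩, fun hf => ?_⟩
  · exact SVSNLTV.exists_isMinimizer_energyLp le_rfl two_ne_zero hΩm hΩb hs hv hμ hlam K hf
  · exact hinj u hu.1 v hv'.1 (SVSNLTV.IsMinimizer.blur_ae_eq hΩm hΩb hs hv hlam hf hu hv')
  · exact SVSNLTV.exists_isMinimizer_energyLp one_le_two one_ne_zero hΩm hΩb hs hv hμ hlam K hf
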